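/- A topological dynamical system is a pair $(X,T)$ with $X$ a compact metric space (with metric $d$) and $T:X\to X$ continuous. It is transitive if for all non-empty open $U,V\subset X$ there is an integer $n\ge 1$ with $T^nU\cap V\neq\emptyset$. Let $B_\delta(x)$ be the open ball of radius $\delta$ centred at $x$. A point $x\in X$ is a diam-mean equicontinuity point if for every $\varepsilon>0$ there is $\delta>0$ such that $$\limsup_{N\to\infty}\frac1N\sum_{i=1}^{N}\operatorname{diam}(T^iB_\delta(x))<\varepsilon,$$ and a Banach diam-mean equicontinuity point if for every $\varepsilon>0$ there is $\delta>0$ such that $$\limsup_{N-M\to\infty}\frac1{N-M}\sum_{i=M+1}^{N}\operatorname{diam}(T^iB_\delta(x))<\varepsilon,$$ where $M,N$ range over the non-negative integers. **Corollary.** There exist a transitive topological dynamical system $(X,T)$ and a point $x\in X$ that is a diam-mean equicontinuity point but not a Banach diam-mean equicontinuity point. -/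

import Mathlib

open Filter

/-- `T` is (topologically) transitive: for any non-empty open sets `U`, `V` there is an integer
`n ≥ 1` with `T^n U ∩ V ≠ ∅`. -/
def IsTransitiveMap {X : Type*} [TopologicalSpace X] (T : X → X) : Prop :=
  ∀ U V : Set X, IsOpen U → IsOpen V → U.Nonempty → V.Nonempty →
    ∃ n : ℕ, 1 ≤ n ∧ ((T^[n] '' U) ∩ V).Nonempty

/-- `x` is a diam-mean equicontinuity point of `T`: for every `ε > 0` there is `δ > 0` with
`limsup_{N → ∞} (1/N) ∑_{i=1}^{N} diam (T^i B_δ(x)) < ε`. -/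
def IsDiamMeanEquicontinuityPoint {X : Type*} [MetricSpace X] (T : X → X) (x : X) : Prop :=
  ∀ ε : ℝ, 0 < ε → ∃ δ : ℝ, 0 < δ ∧
    limsup (fun N : ℕ =>
      (1 / (N : ℝ)) * ∑ i ∈ Finset.Icc 1 N, Metric.diam (T^[i] '' Metric.ball x δ)) atTop < ε

/-- The filter `N - M → ∞` on pairs `(M, N)` of non-negative integers. -/
noncomputable def lengthAtTop : Filter (ℕ × ℕ) :=
  comap (fun p : ℕ × ℕ => (p.2 : ℤ) - (p.1 : ℤ)) atTop

/-- `x` is a Banach diam-mean equicontinuity point of `T`: for every `ε > 0` there is `δ > 0` with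
`limsup_{N - M → ∞} (1/(N-M)) ∑_{i=M+1}^{N} diam (T^i B_δ(x)) < ε`. -/
def IsBanachDiamMeanEquicontinuityPoint {X : Type*} [MetricSpace X] (T : X → X) (x : X) : Prop :=
  ∀ ε : ℝ, 0 < ε → ∃ δ : ℝ, 0 < δ ∧
    limsup (fun p : ℕ × ℕ =>
      (1 / ((p.2 : ℝ) - (p.1 : ℝ))) *
        ∑ i ∈ Finset.Icc (p.1 + 1) p.2, Metric.diam (T^[i] '' Metric.ball x δ)) lengthAtTop < ε

/-!
The system is the orbit closure, under the one-sided shift, of a single sequence `word` over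
`{0, 1, 2}`, and the point is `word` itself. The sequence is built from the symbol `2` by repeating,
at each level `k`, the prefix of length `16 ^ k` once, then writing a run of `k` ones, then zeros up
to position `16 ^ (k + 1)`. Since prefixes reappear, the orbit closure is transitive
(`WordShift.isTransitiveMap_shift`).

Points near `word` start with the symbol `2`, hence are limits of translates of `word` to marks,
the positions carrying a `2`. Two such points can differ at coordinate `i` only if `i` is a return
delay, that is, a difference of a nonzero position and a mark. There are at most `3 ^ m` nonzero
positions below `16 ^ m`, and return delays below `16 ^ m / 2` are realised there
(`exists_mem_wordSupport_of_mem_returnDelays`), so at most `9 ^ m` of them exist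
(`card_returnDelays_le`). They have density zero, which makes the averages of the diameters over
`[1, N]` small.

On the other hand, `word` has ones on `[2 * 16 ^ k, 2 * 16 ^ k + k)`, whereas its translate by
`16 ^ k`, which shares the prefix of length `16 ^ k`, has zeros there. So arbitrarily small balls
have iterates of diameter `1` along arbitrarily long intervals of times
(`WordShift.one_le_diam_image_ball`), which rules out the Banach version.
-/

/-! ### The sequence -/

/-- The sequence over `{0, 1, 2}` generating the example. It starts with the symbol `2`, the block
`[16 ^ k, 2 * 16 ^ k)` repeats the block `[0, 16 ^ k)`, it is followed by a run of `k` ones, and all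
symbols from there up to `16 ^ (k + 1)` are `0`. -/
def word : ℕ → Fin 3
  | 0 => 2
  | i + 1 =>
    if i + 1 < 2 * 16 ^ Nat.log 16 (i + 1) then word (i + 1 - 16 ^ Nat.log 16 (i + 1))
    else if i + 1 < 2 * 16 ^ Nat.log 16 (i + 1) + Nat.log 16 (i + 1) then 1
    else 0
  decreasing_by exact Nat.sub_lt i.succ_pos (by positivity)

theorem word_zero : word 0 = 2 := by rw [word]

theorem word_eq_of_mem_block {i k : ℕ} (h₁ : 16 ^ k ≤ i) (h₂ : i < 16 ^ (k + 1)) :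
    word i = if i < 2 * 16 ^ k then word (i - 16 ^ k)
      else if i < 2 * 16 ^ k + k then 1 else 0 := by
  have hlog : Nat.log 16 i = k := (Nat.log_eq_iff (by omega)).2 ⟨h₁, h₂⟩
  have hpos : 0 < 16 ^ k := by positivity
  obtain ⟨j, rfl⟩ : ∃ j, i = j + 1 := ⟨i - 1, by omega⟩
  rw [word, hlog]

theorem lt_sixteen_pow (k : ℕ) : k < 16 ^ k := Nat.lt_pow_self (by norm_num)

theorem word_add {i k : ℕ} (h : i < 16 ^ k) : word (16 ^ k + i) = word i := by
  rw [word_eq_of_mem_block (k := k) (by omega) (by rw [pow_succ]; omega), if_pos (by omega),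
    Nat.add_sub_cancel_left]

theorem word_run {i k : ℕ} (h : i < k) : word (2 * 16 ^ k + i) = 1 := by
  have := lt_sixteen_pow k
  rw [word_eq_of_mem_block (k := k) (by omega) (by rw [pow_succ]; omega), if_neg (by omega),
    if_pos (by omega)]

theorem word_gap {i k : ℕ} (h₁ : 2 * 16 ^ k + k ≤ i) (h₂ : i < 16 ^ (k + 1)) : word i = 0 := by
  rw [word_eq_of_mem_block (k := k) (by omega) h₂, if_neg (by omega), if_neg (by omega)]

theorem cases_of_word_ne_zero {s k : ℕ} (hs : s < 16 ^ (k + 1)) (h : word s ≠ 0) :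
    s < 16 ^ k ∨ (∃ s' < 16 ^ k, s = 16 ^ k + s' ∧ word s' = word s) ∨
      ∃ t < k, s = 2 * 16 ^ k + t := by
  rcases lt_or_ge s (16 ^ k) with h₁ | h₁
  · exact Or.inl h₁
  rcases lt_or_ge s (2 * 16 ^ k) with h₂ | h₂
  · obtain ⟨s', rfl⟩ := Nat.exists_eq_add_of_le h₁
    exact Or.inr (Or.inl ⟨s', by omega, rfl, (word_add (by omega)).symm⟩)
  rcases lt_or_ge s (2 * 16 ^ k + k) with h₃ | h₃
  · exact Or.inr (Or.inr ⟨s - 2 * 16 ^ k, by omega, by omega⟩)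
  · exact absurd (word_gap h₃ hs) h

theorem two_mul_lt_of_word_eq_two {n k : ℕ} (hn : n < 16 ^ k) (h : word n = 2) :
    2 * n < 16 ^ k := by
  cases k with
  | zero => simp at hn; simp [hn]
  | succ k =>
    have hk := pow_succ 16 k
    rcases cases_of_word_ne_zero hn (by rw [h]; decide) with h' | ⟨s', hs', rfl, -⟩ | ⟨t, ht, rfl⟩
    · omega
    · omega
    · rw [word_run ht] at h
      exact absurd h (by decide)

/-! ### Differences between nonzero positions and marks -/

/-- The positions below `16 ^ k` that carry a nonzero symbol. -/
def wordSupport (k : ℕ) : Finset ℕ := {s ∈ Finset.range (16 ^ k) | word s ≠ 0}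

theorem card_wordSupport_le (k : ℕ) : (wordSupport k).card ≤ 3 ^ k := by
  induction k with
  | zero => exact (Finset.card_filter_le _ _).trans (by simp)
  | succ k ih =>
    have hsub : wordSupport (k + 1) ⊆ (wordSupport k ∪ (wordSupport k).image (16 ^ k + ·)) ∪
        (Finset.range k).image (2 * 16 ^ k + ·) := by
      intro s hs
      simp only [wordSupport, Finset.mem_filter, Finset.mem_range, Finset.mem_union,
        Finset.mem_image] at hs ⊢
      rcases cases_of_word_ne_zero hs.1 hs.2 with h | ⟨s', hs', rfl, hw⟩ | ⟨t, ht, rfl⟩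
      · exact Or.inl (Or.inl ⟨h, hs.2⟩)
      · exact Or.inl (Or.inr ⟨s', ⟨hs', hw ▸ hs.2⟩, rfl⟩)
      · exact Or.inr ⟨t, ht, rfl⟩
    have hcard := (Finset.card_le_card hsub).trans (Finset.card_union_le _ _)
    have h₁ := Finset.card_union_le (wordSupport k) ((wordSupport k).image (16 ^ k + ·))
    have h₂ : ((wordSupport k).image (16 ^ k + ·)).card ≤ _ := Finset.card_image_le
    have h₃ : ((Finset.range k).image (2 * 16 ^ k + ·)).card ≤ _ := Finset.card_image_le
    rw [Finset.card_range] at h₃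
    have h₄ : k < 3 ^ k := Nat.lt_pow_self (by norm_num)
    rw [pow_succ]
    omega

/-- The delays after which some occurrence of the symbol `2` in `word` is followed by a nonzero
symbol. -/
def returnDelays : Set ℕ := {i | ∃ n, word n = 2 ∧ word (n + i) ≠ 0}

/-- A delay below `16 ^ m / 2` already occurs within the first `16 ^ m` symbols. At a level
`k ≥ m`, the marks in each of the blocks `[0, 16 ^ k)` and `[16 ^ k, 2 * 16 ^ k)` occupy only its
first half, so adding `i` does not leave the block, and a pair in the second block can be shifted
back to the first. -/
theorem exists_mem_wordSupport_of_mem_returnDelays {i m : ℕ} (hi : i ∈ returnDelays)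
    (him : 2 * i < 16 ^ m) : ∃ n ∈ wordSupport m, ∃ s ∈ wordSupport m, s - n = i := by
  obtain ⟨n, hn, hs⟩ := hi
  have key : ∀ k n, n + i < 16 ^ k → word n = 2 → word (n + i) ≠ 0 →
      ∃ n ∈ wordSupport m, ∃ s ∈ wordSupport m, s - n = i := by
    intro k
    induction k with
    | zero =>
      intro n hlt hn hs
      have hm : 0 < 16 ^ m := by positivity
      exact ⟨n, by simp [wordSupport, hn]; omega, n + i, by simp [wordSupport, hs]; omega, by omega⟩
    | succ k ih =>
      intro n hlt hn hs
      rcases le_or_gt (k + 1) m with hkm | hkm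
      · have hm : 16 ^ (k + 1) ≤ 16 ^ m := Nat.pow_le_pow_right (by norm_num) hkm
        exact ⟨n, by simp [wordSupport, hn]; omega, n + i, by simp [wordSupport, hs]; omega,
          by omega⟩
      · have hm : 16 ^ m ≤ 16 ^ k := Nat.pow_le_pow_right (by norm_num) (by omega)
        have hn' := cases_of_word_ne_zero (s := n) (k := k) (by omega) (by rw [hn]; decide)
        rcases hn' with hnk | ⟨n', hn'k, rfl, hw⟩ | ⟨t, ht, rfl⟩
        · have := two_mul_lt_of_word_eq_two hnk hn
          exact ih n (by omega) hn hs
        · have := two_mul_lt_of_word_eq_two hn'k (hw.trans hn)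
          rw [add_assoc, word_add (by omega)] at hs
          exact ih n' (by omega) (hw.trans hn) hs
        · rw [word_run ht] at hn
          exact absurd hn (by decide)
  exact key (n + i) n (lt_sixteen_pow _) hn hs

open Classical in
theorem card_returnDelays_le {K m : ℕ} (h : 2 * K ≤ 16 ^ m) :
    ((Finset.range K).filter (· ∈ returnDelays)).card ≤ 9 ^ m := by
  have hsub : (Finset.range K).filter (· ∈ returnDelays) ⊆
      (wordSupport m ×ˢ wordSupport m).image fun p => p.2 - p.1 := by
    intro i hi
    rw [Finset.mem_filter, Finset.mem_range] at hi
    obtain ⟨n, hn, s, hs, rfl⟩ :=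
      exists_mem_wordSupport_of_mem_returnDelays (m := m) hi.2 (by omega)
    exact Finset.mem_image.2 ⟨(n, s), Finset.mk_mem_product hn hs, rfl⟩
  calc _ ≤ _ := Finset.card_le_card hsub
    _ ≤ _ := Finset.card_image_le
    _ = (wordSupport m).card * (wordSupport m).card := Finset.card_product _ _
    _ ≤ 3 ^ m * 3 ^ m := Nat.mul_le_mul (card_wordSupport_le m) (card_wordSupport_le m)
    _ = 9 ^ m := by rw [← mul_pow]; norm_num

/-! ### The orbit closure of the sequence -/

attribute [local instance] PiNat.metricSpace

/-- The orbit closure of `word` under the shift: the sequences all of whose prefixes occur in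
`word`. It carries the metric `PiNat.metricSpace`, for which the distance of two sequences that
first differ at position `n` is `2 ^ (-n)`. -/
abbrev WordShift : Type := {y : ℕ → Fin 3 // ∀ L, ∃ n, ∀ i < L, y i = word (n + i)}

namespace WordShift

theorem dist_le_half_pow_iff {y z : WordShift} {L : ℕ} :
    dist y z ≤ (1 / 2) ^ L ↔ ∀ i < L, y.1 i = z.1 i :=
  PiNat.mem_cylinder_iff_dist_le.symm

theorem dist_le_one (y z : WordShift) : dist y z ≤ 1 := PiNat.dist_le_one _ _

theorem exists_prefix_of_mem_isOpen {U : Set WordShift} (hU : IsOpen U) {y : WordShift}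
    (hy : y ∈ U) : ∃ L, ∀ z : WordShift, (∀ i < L, z.1 i = y.1 i) → z ∈ U := by
  obtain ⟨ε, hε, hball⟩ := Metric.isOpen_iff.1 hU y hy
  obtain ⟨L, hL⟩ := exists_pow_lt_of_lt_one hε (show (1 / 2 : ℝ) < 1 by norm_num)
  exact ⟨L, fun z hz => hball ((dist_le_half_pow_iff.2 hz).trans_lt hL)⟩

instance : CompactSpace WordShift := by
  have hclosed : IsClosed {y : ℕ → Fin 3 | ∀ L, ∃ n, ∀ i < L, y i = word (n + i)} := by
    refine isClosed_of_closure_subset fun y hy L => ?_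
    obtain ⟨z, hz, hzL⟩ := mem_closure_iff.1 hy _ (PiNat.isOpen_cylinder (fun _ => Fin 3) y L)
      (PiNat.self_mem_cylinder y L)
    obtain ⟨n, hn⟩ := hzL L
    exact ⟨n, fun i hi => (hz i hi).symm.trans (hn i hi)⟩
  exact isCompact_iff_compactSpace.1 hclosed.isCompact

/-- The left shift on `WordShift`. -/
def shift (y : WordShift) : WordShift :=
  ⟨fun i => y.1 (i + 1), fun L => by
    obtain ⟨n, hn⟩ := y.2 (L + 1)
    exact ⟨n + 1, fun i hi => (hn (i + 1) (by omega)).trans (by congr 1; omega)⟩⟩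

theorem continuous_shift : Continuous shift :=
  Continuous.subtype_mk (f := fun (y : WordShift) i => y.1 (i + 1)) (continuous_pi fun i =>
    (continuous_apply (i + 1)).comp continuous_subtype_val) _

theorem shift_iterate_apply (n : ℕ) (y : WordShift) (i : ℕ) : (shift^[n] y).1 i = y.1 (n + i) := by
  induction n generalizing y with
  | zero => simp
  | succ n ih =>
    rw [Function.iterate_succ_apply, ih]
    change y.1 (n + i + 1) = _
    rw [show n + i + 1 = n + 1 + i by omega]

/-- The sequence `word` as a point of its orbit closure. -/
def base : WordShift := ⟨word, fun _ => ⟨0, fun i _ => by rw [Nat.zero_add]⟩⟩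

/-- Every prefix of `word` returns at the positions `16 ^ k`, so every word that occurs in `word`
occurs arbitrarily late. -/
theorem isTransitiveMap_shift : IsTransitiveMap shift := by
  rintro U V hU hV ⟨u, hu⟩ ⟨v, hv⟩
  obtain ⟨L, hL⟩ := exists_prefix_of_mem_isOpen hU hu
  obtain ⟨M, hM⟩ := exists_prefix_of_mem_isOpen hV hv
  obtain ⟨n, hn⟩ := u.2 L
  obtain ⟨m, hm⟩ := v.2 M
  have hk := lt_sixteen_pow (n + m + M)
  refine ⟨16 ^ (n + m + M) + m - n, by omega, shift^[16 ^ (n + m + M) + m - n] (shift^[n] base),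
    Set.mem_image_of_mem _ (hL _ fun i hi => ?_), hM _ fun i hi => ?_⟩
  · rw [shift_iterate_apply, hn i hi]
    rfl
  · rw [← Function.iterate_add_apply, Nat.sub_add_cancel (by omega), shift_iterate_apply, hm i hi,
      add_assoc]
    exact word_add (by omega)

/-! ### Diameters of the iterated balls -/

theorem diam_le_one (s : Set WordShift) : Metric.diam s ≤ 1 :=
  Metric.diam_le_of_forall_dist_le zero_le_one fun _ _ _ _ => dist_le_one _ _

/-- A sequence in the ball starts with the symbol `2`, so its nonzero symbols occur only at return
delays. -/
theorem apply_eq_zero_of_mem_ball {y : WordShift} (hy : y ∈ Metric.ball base 1) {i : ℕ}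
    (hi : i ∉ returnDelays) : y.1 i = 0 := by
  have hy0 : y.1 0 = word 0 :=
    PiNat.apply_eq_of_dist_lt (n := 0) (by rw [pow_zero]; exact hy) le_rfl
  obtain ⟨n, hn⟩ := y.2 (i + 1)
  by_contra hne
  refine hi ⟨n, ?_, by rwa [← hn i (by omega)]⟩
  have := hn 0 (by omega)
  rw [← word_zero, ← hy0, this, add_zero]

theorem diam_image_ball_le {i L : ℕ} (h : ∀ j < L, i + j ∉ returnDelays) :
    Metric.diam (shift^[i] '' Metric.ball base 1) ≤ (1 / 2) ^ L := by
  refine Metric.diam_le_of_forall_dist_le (by positivity) ?_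
  rintro _ ⟨y, hy, rfl⟩ _ ⟨z, hz, rfl⟩
  refine dist_le_half_pow_iff.2 fun j hj => ?_
  rw [shift_iterate_apply, shift_iterate_apply, apply_eq_zero_of_mem_ball hy (h j hj),
    apply_eq_zero_of_mem_ball hz (h j hj)]

open Classical in
theorem sum_diam_le {N L m : ℕ} (h : 2 * (N + L + 1) ≤ 16 ^ m) :
    ∑ i ∈ Finset.Icc 1 N, Metric.diam (shift^[i] '' Metric.ball base 1) ≤
      N * (1 / 2) ^ L + L * 9 ^ m := by
  have hterm : ∀ i ∈ Finset.Icc 1 N, Metric.diam (shift^[i] '' Metric.ball base 1) ≤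
      (1 / 2) ^ L + ∑ j ∈ Finset.range L, if i + j ∈ returnDelays then (1 : ℝ) else 0 := by
    intro i _
    have hnonneg : ∀ j ∈ Finset.range L, (0 : ℝ) ≤ if i + j ∈ returnDelays then (1 : ℝ) else 0 :=
      fun j _ => by split_ifs <;> norm_num
    by_cases hi : ∀ j < L, i + j ∉ returnDelays
    · have := Finset.sum_nonneg hnonneg
      linarith [diam_image_ball_le hi]
    · push Not at hi
      obtain ⟨j, hj, hij⟩ := hi
      have h₁ := Finset.single_le_sum hnonneg (Finset.mem_range.2 hj)
      rw [if_pos hij] at h₁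
      have h₂ : (0 : ℝ) ≤ (1 / 2) ^ L := by positivity
      linarith [diam_le_one (shift^[i] '' Metric.ball base 1)]
  have hcount : ∀ j ∈ Finset.range L,
      (∑ i ∈ Finset.Icc 1 N, if i + j ∈ returnDelays then (1 : ℝ) else 0) ≤ 9 ^ m := by
    intro j hj
    rw [Finset.sum_boole]
    have hinj : ((Finset.Icc 1 N).filter (· + j ∈ returnDelays)).card ≤
        ((Finset.range (N + L + 1)).filter (· ∈ returnDelays)).card := by
      refine Finset.card_le_card_of_injOn (· + j) (fun i hi => ?_)
        (add_left_injective j).injOn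
      simp only [Finset.coe_filter, Finset.mem_Icc, Set.mem_ofPred_eq, Finset.mem_range] at hi hj ⊢
      exact ⟨by omega, hi.2⟩
    exact_mod_cast hinj.trans (card_returnDelays_le h)
  calc _ ≤ _ := Finset.sum_le_sum hterm
    _ = N * (1 / 2) ^ L + ∑ j ∈ Finset.range L, ∑ i ∈ Finset.Icc 1 N,
          if i + j ∈ returnDelays then (1 : ℝ) else 0 := by
      rw [Finset.sum_add_distrib, Finset.sum_comm]
      simp
    _ ≤ N * (1 / 2) ^ L + L * 9 ^ m := by
      have := Finset.sum_le_card_nsmul _ _ _ hcount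
      rw [Finset.card_range, nsmul_eq_mul] at this
      linarith

/-- The radius `1` serves every `ε`, since the return delays have density zero: `L` is chosen to
make `2 ^ (-L)` small, and the times within `L` of a return delay are negligible in `[1, N]`. -/
theorem isDiamMeanEquicontinuityPoint_base : IsDiamMeanEquicontinuityPoint shift base := by
  intro ε hε
  refine ⟨1, one_pos, lt_of_le_of_lt ?_ (half_lt_self hε)⟩
  refine limsup_le_of_le (isCoboundedUnder_le_of_le atTop (x := 0) fun N =>
    mul_nonneg (by positivity) (Finset.sum_nonneg fun i _ => Metric.diam_nonneg)) ?_
  obtain ⟨L, hL⟩ := exists_pow_lt_of_lt_one (show 0 < ε / 4 by positivity)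
    (show (1 / 2 : ℝ) < 1 by norm_num)
  have hlim : Tendsto (fun m : ℕ => (81 * L : ℝ) * (9 / 16) ^ m) atTop (nhds 0) := by
    simpa using (tendsto_pow_atTop_nhds_zero_of_lt_one (show (0 : ℝ) ≤ 9 / 16 by norm_num)
      (by norm_num)).const_mul (81 * L : ℝ)
  obtain ⟨m₀, hm₀⟩ := eventually_atTop.1 (hlim.eventually_lt_const (show 0 < ε / 4 by positivity))
  filter_upwards [eventually_ge_atTop (16 ^ m₀), eventually_ge_atTop (L + 1)] with N hN hNL
  set m := Nat.log 16 N
  have hm : m₀ ≤ m := (Nat.le_log_iff_pow_le (by norm_num) (by omega)).2 hN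
  have hlow : 16 ^ m ≤ N := Nat.pow_log_le_self 16 (by omega)
  have hup : N < 16 ^ (m + 1) := Nat.lt_pow_succ_log_self (by norm_num) N
  have hsum := sum_diam_le (N := N) (L := L) (m := m + 2) (by rw [pow_succ]; omega)
  have hNpos : (0 : ℝ) < N := by exact_mod_cast (by omega : 0 < N)
  rw [one_div, inv_mul_le_iff₀ hNpos]
  have h₁ : (N : ℝ) * (1 / 2) ^ L ≤ N * (ε / 4) := by gcongr
  have h₂ : (L : ℝ) * 9 ^ (m + 2) ≤ N * (ε / 4) :=
    calc (L : ℝ) * 9 ^ (m + 2) = 16 ^ m * (81 * L * (9 / 16) ^ m) := by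
          rw [div_pow]; field_simp; ring
      _ ≤ 16 ^ m * (ε / 4) := by gcongr; exact (hm₀ m hm).le
      _ ≤ N * (ε / 4) := by gcongr; exact_mod_cast hlow
  linarith

/-- While `word` reads its run of ones, its translate by `16 ^ k` reads zeros. -/
theorem one_le_diam_image_ball {δ : ℝ} {k : ℕ} (hk : (1 / 2 : ℝ) ^ k < δ) {t : ℕ} (ht : t < k) :
    1 ≤ Metric.diam (shift^[2 * 16 ^ k + t] '' Metric.ball base δ) := by
  have hlt := lt_sixteen_pow k
  have hδ : 0 < δ := lt_trans (by positivity) hk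
  have hmem : shift^[16 ^ k] base ∈ Metric.ball base δ := by
    refine (dist_le_half_pow_iff.2 fun i hi => ?_).trans_lt hk
    rw [shift_iterate_apply]
    exact word_add (by omega)
  have hbdd : Bornology.IsBounded (shift^[2 * 16 ^ k + t] '' Metric.ball base δ) :=
    Metric.isBounded_iff.2 ⟨1, fun _ _ _ _ => dist_le_one _ _⟩
  refine le_trans ?_ (Metric.dist_le_diam_of_mem hbdd
    (Set.mem_image_of_mem _ (Metric.mem_ball_self hδ)) (Set.mem_image_of_mem _ hmem))
  by_contra! hdist
  have heq := PiNat.apply_eq_of_dist_lt (n := 0) (by rw [pow_zero]; exact hdist) le_rfl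
  rw [shift_iterate_apply, shift_iterate_apply, shift_iterate_apply] at heq
  change word (2 * 16 ^ k + t + 0) = word (16 ^ k + (2 * 16 ^ k + t + 0)) at heq
  rw [add_zero, word_run ht, word_gap (k := k) (by omega) (by rw [pow_succ]; omega)] at heq
  exact absurd heq (by decide)

theorem not_isBanachDiamMeanEquicontinuityPoint_base :
    ¬ IsBanachDiamMeanEquicontinuityPoint shift base := by
  intro h
  obtain ⟨δ, hδ, hlt⟩ := h 1 one_pos
  refine hlt.not_ge (le_limsup_of_frequently_le ?_ ?_)
  · have htend : Tendsto (fun k : ℕ => (2 * 16 ^ k - 1, 2 * 16 ^ k - 1 + k)) atTop lengthAtTop := by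
      refine tendsto_comap_iff.2 (tendsto_natCast_atTop_atTop.congr fun k => ?_)
      simp
    refine htend.frequently (Eventually.frequently ?_)
    have hsmall := (tendsto_pow_atTop_nhds_zero_of_lt_one (show (0 : ℝ) ≤ 1 / 2 by norm_num)
      (by norm_num)).eventually_lt_const hδ
    filter_upwards [hsmall, eventually_ge_atTop 1] with k hk hk1
    have hpos : 0 < 16 ^ k := by positivity
    have hterm : ∀ i ∈ Finset.Icc (2 * 16 ^ k - 1 + 1) (2 * 16 ^ k - 1 + k),
        1 ≤ Metric.diam (shift^[i] '' Metric.ball base δ) := by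
      intro i hi
      rw [Finset.mem_Icc] at hi
      have := one_le_diam_image_ball hk (t := i - 2 * 16 ^ k) (by omega)
      rwa [Nat.add_sub_cancel' (by omega)] at this
    have hsum := Finset.card_nsmul_le_sum _ _ _ hterm
    rw [Nat.card_Icc, nsmul_eq_mul, mul_one,
      show 2 * 16 ^ k - 1 + k + 1 - (2 * 16 ^ k - 1 + 1) = k by omega] at hsum
    have hkpos : (0 : ℝ) < k := by exact_mod_cast hk1
    rw [Nat.cast_add, add_sub_cancel_left, one_div, le_inv_mul_iff₀ hkpos, mul_one]
    exact hsum
  · refine isBoundedUnder_of ⟨1, fun p => ?_⟩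
    rcases le_or_gt p.2 p.1 with hp | hp
    · rw [Finset.Icc_eq_empty (by omega), Finset.sum_empty, mul_zero]
      exact zero_le_one
    · have hpos : (0 : ℝ) < (p.2 : ℝ) - p.1 := sub_pos.2 (by exact_mod_cast hp)
      have hsum := Finset.sum_le_card_nsmul (Finset.Icc (p.1 + 1) p.2)
        (fun i => Metric.diam (shift^[i] '' Metric.ball base δ)) 1 fun i _ => diam_le_one _
      rw [Nat.card_Icc, nsmul_eq_mul, mul_one, Nat.add_sub_add_right, Nat.cast_sub hp.le] at hsum
      rw [one_div, inv_mul_le_iff₀ hpos, mul_one]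
      exact hsum

end WordShift

theorem mainTheorem9 :
    ∃ (X : Type) (_ : MetricSpace X) (_ : CompactSpace X) (T : X → X),
      Continuous T ∧ IsTransitiveMap T ∧
        ∃ x : X, IsDiamMeanEquicontinuityPoint T x ∧
          ¬ IsBanachDiamMeanEquicontinuityPoint T x :=
  ⟨WordShift, inferInstance, inferInstance, WordShift.shift, WordShift.continuous_shift,
    WordShift.isTransitiveMap_shift, WordShift.base, WordShift.isDiamMeanEquicontinuityPoint_base,
    WordShift.not_isBanachDiamMeanEquicontinuityPoint_base⟩
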